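/- Theorem 4.1. For a finite graph $\mathcal{G}$ with vertex set $V$ and edge set $E$, let $\mathrm{cox}(\mathcal{G}) = \langle \sigma_v,\ v\in V \mid \sigma_v^2 = e \text{ for all } v\in V,\ [\sigma_v,\sigma_w]=e \text{ for all } \{v,w\}\in E\rangle$ be its right-angled Coxeter group. For $r\in\mathbb{N}=\{0,1,2,\dots\}$ let $\mathcal{A}_r$ be the graph obtained from the complete graph on $r$ vertices by attaching two further vertices that are both adjacent to every vertex of the complete graph, but not to each other. For a finitely generated group $\Gamma$ let $h_n(\Gamma) = |\mathrm{Hom}(\Gamma, S_n)|$, where $S_n$ is the symmetric group on $n$ letters. Then, for every $r\in\mathbb{N}$ and every $x\in\mathbb{C}$ with $|x|<1$, the series $$G_r(x) = \sum_{n=0}^\infty \frac{h_n(\mathrm{cox}(\mathcal{A}_r))}{n!}\, x^n$$ converges absolutely, and $$G_r(x) = \prod_{j=0}^r \left( \left(1-x^{2^{j+1}}\right)^{-s_{2^j}/2} \exp\left(-2^j s_{2^j} + \frac{2^j s_{2^j}}{1-x^{2^j}}\right)\right),$$ where $s_{2^j}$ is the number of subgroups of index $2^j$ of $(\mathbb{Z}/2\mathbb{Z})^r$,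 and the complex powers are taken with the principal branch. -/

import Mathlib

/-- The relators of the right-angled Coxeter group of `G`: the square `σ_v ^ 2` for every vertex `v`
and the commutator `[σ_v, σ_w]` for every edge `{v, w}`. -/
def rightAngledCoxeterRels {V : Type} (G : SimpleGraph V) : Set (FreeGroup V) :=
  {g | ∃ v : V, g = FreeGroup.of v ^ 2} ∪
    {g | ∃ v w : V, G.Adj v w ∧
      g = FreeGroup.of v * FreeGroup.of w * (FreeGroup.of v)⁻¹ * (FreeGroup.of w)⁻¹}

/-- The right-angled Coxeter group of a graph `G`: one generator `σ_v` for each vertex `v`, with the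
relations `σ_v ^ 2 = e` for every vertex `v` and `[σ_v, σ_w] = e` for every edge `{v, w}`. -/
abbrev Cox {V : Type} (G : SimpleGraph V) : Type :=
  PresentedGroup (rightAngledCoxeterRels G)

/-- The graph `𝒜_r`: the complete graph on `r` vertices (the vertices `Sum.inl i`), together with two
further vertices (`Sum.inr 0` and `Sum.inr 1`) that are adjacent to each vertex of the complete
graph, but not to each other. -/
def suspendedCompleteGraph (r : ℕ) : SimpleGraph (Fin r ⊕ Fin 2) where
  Adj a b := a ≠ b ∧ ¬ (a.isRight ∧ b.isRight)
  symm := ⟨fun _ _ h => ⟨h.1.symm, fun h' => h.2 ⟨h'.2, h'.1⟩⟩⟩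
  loopless := ⟨fun _ h => h.1 rfl⟩

/-- `h_n(G)`: the number of homomorphisms from `G` to the symmetric group on `n` letters. -/
noncomputable def numPermReps (n : ℕ) (G : Type) [Group G] : ℕ :=
  Nat.card (G →* Equiv.Perm (Fin n))

/-- `s_n(G)`: the number of subgroups of `G` of index `n` (for `n ≥ 1`). -/
noncomputable def numSubgroups (n : ℕ) (G : Type) [Group G] : ℕ :=
  Nat.card {H : Subgroup G // H.index = n}

/-- The group `(ℤ/2ℤ)^r`, written multiplicatively. -/
abbrev ElemAbTwo (r : ℕ) : Type := Multiplicative (Fin r → ZMod 2)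

/-- The `n`-th term `h_n(Cox(𝒜_r)) x^n / n!` of the exponential generating function. -/
noncomputable def genFunTerm (r : ℕ) (x : ℂ) (n : ℕ) : ℂ :=
  (numPermReps n (Cox (suspendedCompleteGraph r)) : ℂ) / (n.factorial : ℂ) * x ^ n

/-- The exponential generating function `G_r(x) = ∑ h_n(Cox(𝒜_r)) x^n / n!`. -/
noncomputable def genFun (r : ℕ) (x : ℂ) : ℂ :=
  ∑' n : ℕ, genFunTerm r x n

/-! The group splits as `(ℤ/2ℤ)^r × D∞`: the two non-adjacent vertices generate the infinite
dihedral group `D∞ = ℤ/2 * ℤ/2`, and everything else commutes (`coxEquiv`).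

Marshall Hall's recursion (`numPermReps_succ`) says that the exponential generating function `G` of
the `h_n` formally satisfies `G' = G L`, where `L = ∑ s_{i+1} x^i` counts the subgroups of the
Coxeter group. So subgroups of `A × D∞` with `A = (ℤ/2ℤ)^r` must be counted. Since `A` is abelian,
Goursat's lemma parametrizes them by triples `(H, P, f : P → A/H)`, with index `[A:H][D∞:P]`. An
index `m` subgroup of `D∞` is one of `m` infinite dihedral groups, each with `|A/H|^2` homomorphisms
to `A/H`, or, for even `m`, one infinite cyclic group, with `|A/H|` homomorphisms. With `q = [A:H] =
|A/H|` and `m = n/q`, each `H` contributes `nq` if `q ∣ n`, plus `q` if `2q ∣ n`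
(`numSubgroups_elemAbTwo_prod`).

Summed over `n`, these are the coefficients of the logarithmic derivative of one factor of the
product (`hasSum_prodFactorLogDeriv`). The product is holomorphic on the unit disc, solves `F' = F
L` and has value 1 at 0, so its Taylor coefficients obey Hall's recursion and equal `h_n / n!`.
Convergence follows from holomorphy, without any bound on `h_n` (`hasSum_of_recursion`). -/

/-- Embeddings sending a point to a point are embeddings between the complements. -/
def pointedEmbeddingEquiv {α β : Type*} [DecidableEq β] (b : β) (a : α) :
    {f : β ↪ α // f b = a} ≃ ({x : β // x ≠ b} ↪ {y : α // y ≠ a}) where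
  toFun f :=
    { toFun := fun x => ⟨f.1 x.1, fun h => x.2 (f.1.injective (h.trans f.2.symm))⟩
      inj' := fun x y h => Subtype.ext (f.1.injective (congrArg Subtype.val h)) }
  invFun g :=
    ⟨{ toFun := fun x => if h : x = b then a else (g ⟨x, h⟩ : α)
       inj' := by
        intro x y h
        by_cases hx : x = b <;> by_cases hy : y = b
        · rw [hx, hy]
        · simp only [hx, hy, dif_pos, dif_neg, not_false_iff] at h
          exact absurd h.symm (g ⟨y, hy⟩).2
        · simp only [hx, hy, dif_pos, dif_neg, not_false_iff] at h
          exact absurd h (g ⟨x, hx⟩).2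
        · simp only [hx, hy, dif_neg, not_false_iff] at h
          exact congrArg Subtype.val (g.injective (Subtype.ext h)) }, by simp⟩
  left_inv f := by
    ext x
    by_cases hx : x = b
    · simp [hx, f.2]
    · exact dif_neg hx
  right_inv g := by
    ext x
    simp [x.2]

/-- The source of the falling factorial in Hall's recursion: only the `k` points other than `b`
remain to be placed, among `n` others. -/
theorem card_pointedEmbedding {α β : Type*} [Finite α] [Finite β] (b : β) (a : α) {k n : ℕ}
    (hβ : Nat.card β = k + 1) (hα : Nat.card α = n + 1) :
    Nat.card {f : β ↪ α // f b = a} = n.descFactorial k := by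
  classical
  have := Fintype.ofFinite α
  have := Fintype.ofFinite β
  rw [Nat.card_eq_fintype_card] at hα hβ
  rw [Nat.card_congr (pointedEmbeddingEquiv b a), Nat.card_eq_fintype_card,
    Fintype.card_embedding_eq, Fintype.card_subtype_compl, Fintype.card_subtype_compl]
  simp [hα, hβ]

/-! ### Marshall Hall's recursion -/

section HallRecursion

variable {Γ : Type} [Group Γ]

/-- The action on a disjoint union given by actions on both parts. -/
def sumAction (X Y : Type*) [MulAction Γ X] (ψ : Γ →* Equiv.Perm Y) :
    {φ : Γ →* Equiv.Perm (X ⊕ Y) // ∀ g x, φ g (Sum.inl x) = Sum.inl (g • x)} :=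
  ⟨(Equiv.Perm.sumCongrHom X Y).comp ((MulAction.toPermHom Γ X).prod ψ), fun g x => by simp⟩

/-- The complement of an invariant set is invariant, so the only freedom lies in the action on `Y`.
-/
theorem sumAction_bijective (X Y : Type*) [MulAction Γ X] :
    Function.Bijective (sumAction (Γ := Γ) X Y) := by
  refine ⟨fun ψ ψ' h => ?_, fun φ => ?_⟩
  · ext g y
    have := congrArg (fun φ => φ.1 g (Sum.inr y)) h
    simpa [sumAction] using this
  · have key : ∀ g y, ∃ z, φ.1 g (Sum.inr y) = Sum.inr z := by
      intro g y
      rcases h : φ.1 g (Sum.inr y) with x | z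
      · have h1 := φ.2 g (g⁻¹ • x)
        rw [smul_inv_smul, ← h] at h1
        simp at h1
      · exact ⟨z, rfl⟩
    choose F hF using key
    -- An action of a group by mere functions is automatically by permutations; `toHomPerm` below
    -- uses this.
    let A : Γ →* Function.End Y :=
      { toFun := F
        map_one' := by
          funext y
          have := hF 1 y
          simp only [map_one, Equiv.Perm.one_apply, Sum.inr.injEq] at this
          exact this.symm
        map_mul' := by
          intro g h
          funext y
          have h1 := hF (g * h) y
          rw [map_mul, Equiv.Perm.mul_apply, hF h y, hF g] at h1
          exact (Sum.inr.inj h1).symm }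
    refine ⟨A.toHomPerm, ?_⟩
    ext g z
    rcases z with x | y
    · rw [φ.2]
      rfl
    · rw [hF]
      rfl

/-- With the action prescribed on the range of `f`, what is left is an arbitrary action on the `m`
points outside it. -/
theorem card_extendAction {X α : Type} [Finite α] [MulAction Γ X] (f : X ↪ α) {m : ℕ}
    (h : Nat.card X + m = Nat.card α) :
    Nat.card {φ : Γ →* Equiv.Perm α // ∀ g x, φ g (f x) = f (g • x)} = numPermReps m Γ := by
  classical
  have hX : Finite X := Finite.of_injective f f.injective
  let e : X ⊕ {y // y ∉ Set.range f} ≃ α :=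
    ((Equiv.ofInjective f f.injective).sumCongr (Equiv.refl _)).trans
      (Equiv.sumCompl (· ∈ Set.range f))
  have he : ∀ x, e (Sum.inl x) = f x := fun x => by simp [e]
  have hm : Nat.card {y // y ∉ Set.range f} = m := by
    have := Nat.card_congr e
    rw [Nat.card_sum] at this
    omega
  have e2 : {y // y ∉ Set.range f} ≃ Fin m := Finite.equivFinOfCardEq hm
  rw [numPermReps, ← Nat.card_congr (e2.permCongrHom.monoidHomCongrRightEquiv (M := Γ)),
    Nat.card_congr (Equiv.ofBijective _ (sumAction_bijective X {y // y ∉ Set.range f}))]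
  refine Nat.card_congr ((Equiv.subtypeEquiv
    (e.permCongrHom.monoidHomCongrRightEquiv (M := Γ)) ?_).symm)
  intro φ
  refine forall₂_congr fun g x => ?_
  simp [← he, Equiv.permCongrHom]

/-- The stabilizer of a point under a permutation representation. -/
def pointStabilizer {α : Type*} (a : α) (φ : Γ →* Equiv.Perm α) : Subgroup Γ :=
  (MulAction.stabilizer (Equiv.Perm α) a).comap φ

theorem mem_pointStabilizer {α : Type*} {a : α} {φ : Γ →* Equiv.Perm α} {g : Γ} :
    g ∈ pointStabilizer a φ ↔ φ g a = a := Iff.rfl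

/-- The orbit map of a point, as an embedding of the quotient by its stabilizer. -/
def orbitEmbedding {α : Type*} (a : α) (φ : Γ →* Equiv.Perm α) {K : Subgroup Γ}
    (h : pointStabilizer a φ = K) : Γ ⧸ K ↪ α where
  toFun := Quotient.lift (fun g => φ g a) (by
    intro g g' hg
    have : g⁻¹ * g' ∈ pointStabilizer a φ := h ▸ QuotientGroup.leftRel_apply.1 hg
    rw [mem_pointStabilizer, map_mul, map_inv, Equiv.Perm.mul_apply,
      Equiv.Perm.inv_eq_iff_eq] at this
    exact this.symm)
  inj' := by
    rintro ⟨g⟩ ⟨g'⟩ hg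
    change φ g a = φ g' a at hg
    refine Quotient.sound (QuotientGroup.leftRel_apply.2 ?_)
    rw [← h, mem_pointStabilizer, map_mul, map_inv, Equiv.Perm.mul_apply,
      Equiv.Perm.inv_eq_iff_eq]
    exact hg.symm

theorem orbitEmbedding_mk {α : Type*} (a : α) (φ : Γ →* Equiv.Perm α) {K : Subgroup Γ}
    (h : pointStabilizer a φ = K) (g : Γ) : orbitEmbedding a φ h (g : Γ ⧸ K) = φ g a := rfl

/-- The point stabilizer of a representation whose orbit map is an embedding of `Γ ⧸ K`. -/
def stabilizerFiberMap {α : Type*} (a : α) (K : Subgroup Γ)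
    (p : Σ f : {f : Γ ⧸ K ↪ α // f ((1 : Γ) : Γ ⧸ K) = a},
        {φ : Γ →* Equiv.Perm α // ∀ g x, φ g (f.1 x) = f.1 (g • x)}) :
    {φ : Γ →* Equiv.Perm α // pointStabilizer a φ = K} :=
  ⟨p.2.1, by
    obtain ⟨⟨f, hf⟩, φ, hφ⟩ := p
    ext g
    rw [mem_pointStabilizer]
    have := hφ g ((1 : Γ) : Γ ⧸ K)
    simp only [hf] at this
    rw [this, ← hf, f.injective.eq_iff, MulAction.Quotient.smul_coe,
      smul_eq_mul, mul_one, QuotientGroup.eq, mul_one, inv_mem_iff]⟩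

/-- A representation in which `a` has stabilizer `K` admits exactly one equivariant embedding of `Γ
⧸ K` taking the base coset to `a`, namely the orbit map. -/
theorem stabilizerFiberMap_bijective {α : Type*} (a : α) (K : Subgroup Γ) :
    Function.Bijective (stabilizerFiberMap a K) := by
  constructor
  · rintro ⟨⟨f, hf⟩, φ, hφ⟩ ⟨⟨f', hf'⟩, φ', hφ'⟩ h
    obtain rfl : φ = φ' := congrArg Subtype.val h
    have h1 : ∀ (f : Γ ⧸ K ↪ α), f ((1 : Γ) : Γ ⧸ K) = a →
        (∀ g x, φ g (f x) = f (g • x)) → ∀ g : Γ, f g = φ g a := by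
      intro f hf hφ g
      rw [← hf, hφ, MulAction.Quotient.smul_coe, smul_eq_mul, mul_one]
    obtain rfl : f = f' := by
      ext ⟨g⟩
      exact (h1 f hf hφ g).trans (h1 f' hf' hφ' g).symm
    rfl
  · rintro ⟨φ, hφ⟩
    refine ⟨⟨⟨orbitEmbedding a φ hφ, by simp [orbitEmbedding_mk]⟩, φ, ?_⟩, rfl⟩
    rintro g ⟨x⟩
    change φ g (φ x a) = φ (g * x) a
    simp

theorem card_stabilizerFiber (hfin : ∀ m, Finite (Γ →* Equiv.Perm (Fin m)))
    (K : Subgroup Γ) {n k : ℕ} (hk : K.index = k + 1) (hkn : k ≤ n) :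
    Nat.card {φ : Γ →* Equiv.Perm (Fin (n + 1)) // pointStabilizer 0 φ = K} =
      n.descFactorial k * numPermReps (n - k) Γ := by
  have hK : Nat.card (Γ ⧸ K) = k + 1 := hk
  have : Finite (Γ ⧸ K) := Nat.finite_of_card_ne_zero (by omega)
  rw [← Nat.card_congr (Equiv.ofBijective _ (stabilizerFiberMap_bijective 0 K))]
  have hc : ∀ f : {f : Γ ⧸ K ↪ Fin (n + 1) // f ((1 : Γ) : Γ ⧸ K) = 0},
      Nat.card {φ : Γ →* Equiv.Perm (Fin (n + 1)) // ∀ g x, φ g (f.1 x) = f.1 (g • x)} =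
        numPermReps (n - k) Γ := fun f => card_extendAction f.1 (by
      rw [hK, Nat.card_fin]; omega)
  have := Fintype.ofFinite {f : Γ ⧸ K ↪ Fin (n + 1) // f ((1 : Γ) : Γ ⧸ K) = 0}
  have hfin : ∀ m, Finite (Γ →* Equiv.Perm (Fin m)) := hfin
  rw [Nat.card_sigma, Finset.sum_congr rfl fun f _ => hc f, Finset.sum_const, Finset.card_univ,
    ← Nat.card_eq_fintype_card, card_pointedEmbedding _ _ hK (Nat.card_fin _), smul_eq_mul]

theorem index_pointStabilizer_le {n : ℕ} (φ : Γ →* Equiv.Perm (Fin (n + 1))) :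
    ∃ k ∈ Finset.range (n + 1), (pointStabilizer 0 φ).index = k + 1 := by
  have e := orbitEmbedding 0 φ rfl
  have : Finite (Γ ⧸ pointStabilizer 0 φ) := Finite.of_injective e e.injective
  have h1 := Nat.card_le_card_of_injective e e.injective
  have h2 : 0 < Nat.card (Γ ⧸ pointStabilizer 0 φ) := Nat.card_pos
  rw [Nat.card_fin] at h1
  refine ⟨Nat.card (Γ ⧸ pointStabilizer 0 φ) - 1, by rw [Finset.mem_range]; omega, ?_⟩
  rw [Subgroup.index]
  omega

/-- Marshall Hall's recursion between numbers of permutation representations and numbers of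
subgroups. -/
theorem numPermReps_succ (hfin : ∀ n, Finite (Γ →* Equiv.Perm (Fin n))) (n : ℕ) :
    numPermReps (n + 1) Γ = ∑ k ∈ Finset.range (n + 1),
      n.descFactorial k * numSubgroups (k + 1) Γ * numPermReps (n - k) Γ := by
  classical
  have := Fintype.ofFinite (Γ →* Equiv.Perm (Fin (n + 1)))
  -- `d φ` is the index of the stabilizer of `0`, minus one; this is the summation index of the
  -- recursion.
  choose d hd hd' using index_pointStabilizer_le (Γ := Γ) (n := n)
  rw [numPermReps, Nat.card_eq_fintype_card, ← Finset.card_univ,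
    Finset.card_eq_sum_card_fiberwise (f := d) (t := Finset.range (n + 1))
      (fun φ _ => hd φ)]
  refine Finset.sum_congr rfl fun k hk => ?_
  rw [Finset.mem_range] at hk
  -- The fibre size depends on `k` only, so the sigma type becomes a product, and `Nat.card_prod`
  -- needs no finiteness of the set of subgroups.
  have h1 : ∀ K : {K : Subgroup Γ // K.index = k + 1}, Nonempty
      ({φ : Γ →* Equiv.Perm (Fin (n + 1)) // pointStabilizer 0 φ = K.1} ≃
        Fin (n.descFactorial k * numPermReps (n - k) Γ)) := fun K =>
    ⟨Finite.equivFinOfCardEq (card_stabilizerFiber hfin K.1 K.2 (by omega))⟩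
  have e : {φ : Γ →* Equiv.Perm (Fin (n + 1)) // d φ = k} ≃
      {K : Subgroup Γ // K.index = k + 1} × Fin (n.descFactorial k * numPermReps (n - k) Γ) :=
    ((Equiv.sigmaSubtypeFiberEquivSubtype (pointStabilizer 0)
      (q := fun K => K.index = k + 1) (fun φ => by
        show d φ = k ↔ _
        rw [hd']; omega)).symm.trans (Equiv.sigmaCongrRight fun K => (h1 K).some)).trans
      (Equiv.sigmaEquivProd _ _)
  have h2 := Nat.card_congr e
  rw [Nat.card_prod, Nat.card_fin, Nat.card_eq_fintype_card, Fintype.card_subtype] at h2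
  rw [h2, numSubgroups]
  ring

end HallRecursion

/-! ### Universal properties of the infinite dihedral group and of `(ℤ/2ℤ)^r` -/

namespace DihedralGroup

/-- The homomorphism from the infinite dihedral group given by two elements of order dividing 2. -/
def liftInvolutions {G : Type*} [Group G] (a b : G) (ha : a * a = 1) (hb : b * b = 1) :
    DihedralGroup 0 →* G :=
  have key : ∀ i : ℤ, (a * b) ^ i * a = a * (a * b) ^ (-i) := by
    intro i
    -- Conjugation by an involution inverts its product with another involution: the defining
    -- dihedral relation.
    have h : a * (a * b) * a⁻¹ = (a * b)⁻¹ := by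
      rw [mul_inv_rev, eq_comm, inv_eq_of_mul_eq_one_left ha, inv_eq_of_mul_eq_one_left hb,
        ← mul_assoc, ha, one_mul]
    have h2 := conj_zpow (i := -i) (a := a) (b := a * b)
    rw [h, inv_zpow, zpow_neg, inv_inv] at h2
    rw [h2, inv_mul_cancel_right, zpow_neg]
  MonoidHom.mk'
    (fun g => match g with
      | r i => (a * b) ^ (show ℤ from i)
      | sr i => a * (a * b) ^ (show ℤ from i)) (by
    have h2 : ∀ i j : ℤ, a * (a * b) ^ (j - i) = (a * b) ^ i * (a * (a * b) ^ j) := by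
      intro i j
      rw [← mul_assoc, key, mul_assoc, ← zpow_add, neg_add_eq_sub]
    have h3 : ∀ i j : ℤ, a * (a * b) ^ (i + j) = a * (a * b) ^ i * (a * b) ^ j := by
      intro i j
      rw [mul_assoc, ← zpow_add]
    have h4 : ∀ i j : ℤ, (a * b) ^ (j - i) = a * (a * b) ^ i * (a * (a * b) ^ j) := by
      intro i j
      rw [mul_assoc, ← h2, ← mul_assoc, ha, one_mul]
    rintro (i | i) (j | j)
    · exact zpow_add (a * b) i j
    · exact h2 i j
    · exact h3 i j
    · exact h4 i j)

section

variable {G : Type*} [Group G] (a b : G) (ha : a * a = 1) (hb : b * b = 1)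

theorem liftInvolutions_sr_zero : liftInvolutions a b ha hb (sr 0) = a := by
  change a * (a * b) ^ (0 : ℤ) = a
  simp

theorem liftInvolutions_sr_one : liftInvolutions a b ha hb (sr 1) = b := by
  change a * (a * b) ^ (1 : ℤ) = b
  rw [zpow_one, ← mul_assoc, ha, one_mul]

/-- The two reflections generate: `r i = (sr 0 * sr 1) ^ i` and `sr i = sr 0 * r i`. -/
theorem hom_ext_of_sr {f g : DihedralGroup 0 →* G} (h0 : f (sr 0) = g (sr 0))
    (h1 : f (sr 1) = g (sr 1)) : f = g := by
  have hr : ∀ i : ℤ, f (r i) = g (r i) := by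
    intro i
    have e : (r i : DihedralGroup 0) = (sr 0 * sr 1) ^ i := by
      rw [sr_mul_sr, r_zpow, sub_zero, one_mul]
      rfl
    rw [e, map_zpow, map_zpow, map_mul, map_mul, h0, h1]
  ext (i | i)
  · exact hr i
  · have e : (sr i : DihedralGroup 0) = sr 0 * r i := by simp
    rw [e, map_mul, map_mul, h0]
    exact congrArg _ (hr i)

theorem commute_liftInvolutions {x : G} (hxa : Commute x a) (hxb : Commute x b)
    (d : DihedralGroup 0) : Commute x (liftInvolutions a b ha hb d) := by
  rcases d with i | i
  · exact (hxa.mul_right hxb).zpow_right _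
  · exact hxa.mul_right ((hxa.mul_right hxb).zpow_right _)

/-- Homomorphisms from the infinite dihedral group to a group of exponent dividing 2. -/
def homEquivOfExponentTwo (hG : ∀ x : G, x * x = 1) : (DihedralGroup 0 →* G) ≃ G × G where
  toFun f := (f (sr 0), f (sr 1))
  invFun p := liftInvolutions p.1 p.2 (hG _) (hG _)
  left_inv _ := hom_ext_of_sr (liftInvolutions_sr_zero _ _ _ _) (liftInvolutions_sr_one _ _ _ _)
  right_inv _ := Prod.ext (liftInvolutions_sr_zero _ _ _ _) (liftInvolutions_sr_one _ _ _ _)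

end

end DihedralGroup

/-- The homomorphism from `ℤ/2ℤ` given by an element of order dividing 2. -/
def zmodTwoLift {G : Type*} [Group G] (a : G) (ha : a * a = 1) : Multiplicative (ZMod 2) →* G :=
  MonoidHom.mk' (fun z => a ^ (z.toAdd).val) (by
    have h2 : ∀ x y : ZMod 2, ((x + y).val) % 2 = (x.val + y.val) % 2 := by decide
    have h : ∀ x y : ZMod 2, a ^ (x + y).val = a ^ x.val * a ^ y.val := by
      intro x y
      rw [← pow_add]
      exact pow_eq_pow_of_modEq (h2 x y) (by rw [sq, ha])
    exact fun x y => h x.toAdd y.toAdd)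

theorem zmodTwoLift_ofAdd_one {G : Type*} [Group G] (a : G) (ha : a * a = 1) :
    zmodTwoLift a ha (Multiplicative.ofAdd 1) = a :=
  pow_one a

theorem commute_zmodTwoLift {G : Type*} [Group G] {r : ℕ} (s : Fin r → G)
    (hs : ∀ i, s i * s i = 1) (hc : ∀ i j, Commute (s i) (s j)) :
    Pairwise fun i j => ∀ x y, Commute (zmodTwoLift (s i) (hs i) x)
      (zmodTwoLift (s j) (hs j) y) :=
  fun i j _ _ _ => (hc i j).pow_pow _ _

theorem zmodTwo_hom_ext {G : Type*} [Group G] {f g : Multiplicative (ZMod 2) →* G}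
    (h : f (Multiplicative.ofAdd 1) = g (Multiplicative.ofAdd 1)) : f = g := by
  refine MonoidHom.ext fun x => ?_
  have : ∀ y : ZMod 2, f (Multiplicative.ofAdd y) = g (Multiplicative.ofAdd y) := by
    intro y
    fin_cases y
    · exact f.map_one.trans g.map_one.symm
    · exact h
  exact this x.toAdd

theorem elemAbTwo_mul_self {r : ℕ} (a : ElemAbTwo r) : a * a = 1 := by
  have h : ∀ x : ZMod 2, x + x = 0 := by decide
  exact congrArg Multiplicative.ofAdd (funext fun i => h (a.toAdd i))

/-- The `i`-th standard generator of `(ℤ/2ℤ)^r`. -/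
def elemAbTwoGen {r : ℕ} (i : Fin r) : ElemAbTwo r := Multiplicative.ofAdd (Pi.single i 1)

/-- The homomorphism from `(ℤ/2ℤ)^r` given by commuting elements of order dividing 2. -/
def elemAbTwoLift {G : Type*} [Group G] {r : ℕ} (s : Fin r → G) (hs : ∀ i, s i * s i = 1)
    (hc : ∀ i j, Commute (s i) (s j)) : ElemAbTwo r →* G :=
  (MonoidHom.noncommPiCoprod (fun i => zmodTwoLift (s i) (hs i)) (commute_zmodTwoLift s hs hc)).comp
    (MulEquiv.piMultiplicative (fun _ : Fin r => ZMod 2)).toMonoidHom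

theorem elemAbTwoLift_gen {G : Type*} [Group G] {r : ℕ} (s : Fin r → G)
    (hs : ∀ i, s i * s i = 1) (hc : ∀ i j, Commute (s i) (s j)) (i : Fin r) :
    elemAbTwoLift s hs hc (elemAbTwoGen i) = s i := by
  have h : MulEquiv.piMultiplicative (fun _ : Fin r => ZMod 2) (elemAbTwoGen i) =
      Pi.mulSingle i (Multiplicative.ofAdd 1) := by
    funext j
    by_cases hj : j = i
    · subst hj
      simp [MulEquiv.piMultiplicative, elemAbTwoGen]
    · simp [MulEquiv.piMultiplicative, elemAbTwoGen, hj]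
  refine (congrArg (MonoidHom.noncommPiCoprod (fun i => zmodTwoLift (s i) (hs i))
    (commute_zmodTwoLift s hs hc)) h).trans ?_
  rw [MonoidHom.noncommPiCoprod_mulSingle, zmodTwoLift_ofAdd_one]

theorem commute_elemAbTwoLift {G : Type*} [Group G] {r : ℕ} (s : Fin r → G)
    (hs : ∀ i, s i * s i = 1) (hc : ∀ i j, Commute (s i) (s j)) {x : G}
    (hx : ∀ i, Commute x (s i)) (a : ElemAbTwo r) : Commute x (elemAbTwoLift s hs hc a) :=
  Finset.noncommProd_commute Finset.univ
    (fun i => zmodTwoLift (s i) (hs i) (MulEquiv.piMultiplicative (fun _ : Fin r => ZMod 2) a i))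
    (fun _ _ _ _ h => commute_zmodTwoLift s hs hc h _ _) x fun i _ => (hx i).pow_right _

theorem elemAbTwo_hom_ext {G : Type*} [Group G] {r : ℕ} {f g : ElemAbTwo r →* G}
    (h : ∀ i, f (elemAbTwoGen i) = g (elemAbTwoGen i)) : f = g := by
  let e := MulEquiv.piMultiplicative (fun _ : Fin r => ZMod 2)
  have h2 : f.comp e.symm.toMonoidHom = g.comp e.symm.toMonoidHom := by
    refine MonoidHom.pi_ext fun i x => ?_
    have h3 : (f.comp e.symm.toMonoidHom).comp (MonoidHom.mulSingle _ i) =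
        (g.comp e.symm.toMonoidHom).comp (MonoidHom.mulSingle _ i) := by
      refine zmodTwo_hom_ext ?_
      have h4 : e.symm (Pi.mulSingle i (Multiplicative.ofAdd 1)) = elemAbTwoGen i := by
        rw [MulEquiv.symm_apply_eq]
        funext j
        by_cases hj : j = i
        · subst hj
          simp [e, MulEquiv.piMultiplicative, elemAbTwoGen]
        · simp [e, MulEquiv.piMultiplicative, elemAbTwoGen, hj]
      change f (e.symm (Pi.mulSingle i (Multiplicative.ofAdd 1))) =
        g (e.symm (Pi.mulSingle i (Multiplicative.ofAdd 1)))
      rw [h4]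
      exact h i
    exact DFunLike.congr_fun h3 x
  refine MonoidHom.ext fun x => ?_
  have := DFunLike.congr_fun h2 (e x)
  change f (e.symm (e x)) = g (e.symm (e x)) at this
  rwa [e.symm_apply_apply] at this

/-! ### The Coxeter group as a direct product -/

section CoxeterIso

open DihedralGroup

variable (r : ℕ)

theorem cox_of_mul_self {V : Type} (G : SimpleGraph V) (v : V) :
    (PresentedGroup.of v : Cox G) * PresentedGroup.of v = 1 := by
  have : (PresentedGroup.mk (rightAngledCoxeterRels G)) (FreeGroup.of v ^ 2) = 1 :=
    PresentedGroup.one_of_mem (Or.inl ⟨v, rfl⟩)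
  rwa [map_pow, sq] at this

theorem cox_of_commute {V : Type} (G : SimpleGraph V) {v w : V} (h : G.Adj v w) :
    Commute (PresentedGroup.of v : Cox G) (PresentedGroup.of w) := by
  have : (PresentedGroup.mk (rightAngledCoxeterRels G))
      (FreeGroup.of v * FreeGroup.of w * (FreeGroup.of v)⁻¹ * (FreeGroup.of w)⁻¹) = 1 :=
    PresentedGroup.one_of_mem (Or.inr ⟨v, w, h, rfl⟩)
  simp only [map_mul, map_inv] at this
  exact mul_inv_eq_iff_eq_mul.1 (mul_inv_eq_one.1 this)

/-- The images of the Coxeter generators in `(ℤ/2ℤ)^r × D∞`. -/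
def coxGenImage : Fin r ⊕ Fin 2 → ElemAbTwo r × DihedralGroup 0
  | Sum.inl i => (elemAbTwoGen i, 1)
  | Sum.inr j => (1, sr ((j : ℕ) : ZMod 0))

/-- The map `Cox(𝒜_r) → (ℤ/2ℤ)^r × D∞`. -/
def coxToProd : Cox (suspendedCompleteGraph r) →* ElemAbTwo r × DihedralGroup 0 :=
  PresentedGroup.toGroup (f := coxGenImage r) (by
    rintro g (⟨v, rfl⟩ | ⟨v, w, h, rfl⟩)
    · rw [map_pow, FreeGroup.lift_apply_of, sq]
      rcases v with i | j
      · simp [coxGenImage, elemAbTwo_mul_self]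
      · simp [coxGenImage]
    · simp only [map_mul, map_inv, FreeGroup.lift_apply_of]
      rw [mul_inv_eq_one, mul_inv_eq_iff_eq_mul]
      rcases v with i | j <;> rcases w with i' | j'
      · simp [coxGenImage, mul_comm]
      · simp [coxGenImage]
      · simp [coxGenImage]
      · exact absurd ⟨rfl, rfl⟩ h.2)

/-- The map `(ℤ/2ℤ)^r × D∞ → Cox(𝒜_r)`. -/
def prodToCox : ElemAbTwo r × DihedralGroup 0 →* Cox (suspendedCompleteGraph r) :=
  MonoidHom.noncommCoprod
    (elemAbTwoLift (fun i => PresentedGroup.of (Sum.inl i)) (fun _ => cox_of_mul_self _ _)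
      (fun i j => by
        by_cases h : i = j
        · rw [h]
        · exact cox_of_commute _ ⟨by simpa using h, by simp⟩))
    (liftInvolutions (PresentedGroup.of (Sum.inr 0)) (PresentedGroup.of (Sum.inr 1))
      (cox_of_mul_self _ _) (cox_of_mul_self _ _)) (by
    intro a d
    have hc : ∀ i j, Commute (PresentedGroup.of (Sum.inl i) : Cox (suspendedCompleteGraph r))
        (PresentedGroup.of (Sum.inr j)) := fun i j =>
      cox_of_commute _ ⟨by simp, by simp⟩
    exact (commute_elemAbTwoLift _ _ _ (fun i =>
      (commute_liftInvolutions _ _ _ _ (hc i 0) (hc i 1) d).symm) a).symm)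

theorem coxToProd_of (v) : coxToProd r (PresentedGroup.of v) = coxGenImage r v :=
  PresentedGroup.toGroup.of _

/-- `Cox(𝒜_r) ≅ (ℤ/2ℤ)^r × D∞`. -/
def coxEquiv : Cox (suspendedCompleteGraph r) ≃* ElemAbTwo r × DihedralGroup 0 :=
  MonoidHom.toMulEquiv (coxToProd r) (prodToCox r)
    (by
      refine PresentedGroup.ext fun v => ?_
      rw [MonoidHom.comp_apply, coxToProd_of]
      rcases v with i | j
      · simp [coxGenImage, prodToCox, elemAbTwoLift_gen]
      · fin_cases j
        · simp [coxGenImage, prodToCox, liftInvolutions_sr_zero]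
        · simp [coxGenImage, prodToCox, liftInvolutions_sr_one])
    (by
      have h1 : ((coxToProd r).comp (prodToCox r)).comp (MonoidHom.inl _ _) =
          MonoidHom.inl _ _ := by
        refine elemAbTwo_hom_ext fun i => ?_
        simp [prodToCox, elemAbTwoLift_gen, coxToProd_of, coxGenImage]
      have h2 : ((coxToProd r).comp (prodToCox r)).comp (MonoidHom.inr _ _) =
          MonoidHom.inr _ _ := by
        refine hom_ext_of_sr ?_ ?_
        · simp [prodToCox, liftInvolutions_sr_zero, coxToProd_of, coxGenImage]
        · simp [prodToCox, liftInvolutions_sr_one, coxToProd_of, coxGenImage]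
      ext1 ⟨a, d⟩
      have e : (a, d) = MonoidHom.inl _ _ a * MonoidHom.inr _ _ d := by simp
      rw [e, map_mul]
      exact congrArg₂ _ (DFunLike.congr_fun h1 a) (DFunLike.congr_fun h2 d))

end CoxeterIso

/-- Images of the generators determine a homomorphism. This supplies the finiteness assumed in
Hall's recursion. -/
theorem finite_presentedGroup_hom {V G : Type*} [Finite V] [Group G] [Finite G]
    (R : Set (FreeGroup V)) : Finite (PresentedGroup R →* G) :=
  Finite.of_injective (fun f v => f (PresentedGroup.of v))
    fun _ _ h => PresentedGroup.ext fun v => congrFun h v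

theorem numSubgroups_congr {G H : Type} [Group G] [Group H] (e : G ≃* H) (n : ℕ) :
    numSubgroups n G = numSubgroups n H :=
  Nat.card_congr (Equiv.subtypeEquiv e.mapSubgroup.toEquiv fun K => by
    have := Subgroup.index_map_equiv K e
    simp only [MulEquiv.mapSubgroup]
    exact ⟨fun h => this.trans h, fun h => this.symm.trans h⟩)

/-! ### Goursat's lemma and subgroups of a product -/

section Goursat

variable {A D : Type*} [CommGroup A] [Group D]

/-- The subgroup of `A × D` given by `H ≤ A`, `P ≤ D` and a homomorphism `P → A ⧸ H`. -/
def goursatSubgroup (H : Subgroup A) (P : Subgroup D) (f : P →* A ⧸ H) : Subgroup (A × D) where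
  carrier := {p | ∃ h : p.2 ∈ P, f ⟨p.2, h⟩ = (p.1 : A ⧸ H)}
  one_mem' := ⟨P.one_mem, f.map_one⟩
  mul_mem' := by
    rintro ⟨a, d⟩ ⟨a', d'⟩ ⟨h, e⟩ ⟨h', e'⟩
    refine ⟨P.mul_mem h h', ?_⟩
    simp only [Prod.mk_mul_mk, QuotientGroup.mk_mul]
    rw [← e, ← e', ← map_mul]
    rfl
  inv_mem' := by
    rintro ⟨a, d⟩ ⟨h, e⟩
    refine ⟨P.inv_mem h, ?_⟩
    simp only [Prod.inv_mk, QuotientGroup.mk_inv]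
    rw [← e, ← map_inv]
    rfl

theorem mem_goursatSubgroup {H : Subgroup A} {P : Subgroup D} {f : P →* A ⧸ H} {a : A} {d : D} :
    (a, d) ∈ goursatSubgroup H P f ↔ ∃ h : d ∈ P, f ⟨d, h⟩ = (a : A ⧸ H) := Iff.rfl

/-- Inside `Q = A × P`, whose index is that of `P`, the subgroup is the kernel of the surjection
`(a, d) ↦ (f d)⁻¹ a` onto `A ⧸ H`; commutativity of `A` makes this map a homomorphism. -/
theorem index_goursatSubgroup (H : Subgroup A) (P : Subgroup D) (f : P →* A ⧸ H) :
    (goursatSubgroup H P f).index = H.index * P.index := by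
  let Q : Subgroup (A × D) := P.comap (MonoidHom.snd A D)
  have hle : goursatSubgroup H P f ≤ Q := fun p hp => hp.1
  have hQ : Q.index = P.index := P.index_comap_of_surjective Prod.snd_surjective
  let π : Q →* P := ((MonoidHom.snd A D).comp Q.subtype).codRestrict P fun q => q.2
  let ψ : Q →* A ⧸ H :=
    (f.comp π)⁻¹ * (QuotientGroup.mk' H).comp ((MonoidHom.fst A D).comp Q.subtype)
  have hψ : Function.Surjective ψ := by
    rintro ⟨a⟩
    refine ⟨⟨(a, 1), P.one_mem⟩, ?_⟩
    have : π ⟨(a, 1), P.one_mem⟩ = 1 := rfl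
    simp only [ψ, MonoidHom.mul_apply, MonoidHom.inv_apply, MonoidHom.comp_apply, this, map_one,
      inv_one, one_mul]
    rfl
  have hker : (goursatSubgroup H P f).subgroupOf Q = ψ.ker := by
    ext ⟨⟨a, d⟩, hd⟩
    rw [Subgroup.mem_subgroupOf, MonoidHom.mem_ker]
    change (a, d) ∈ goursatSubgroup H P f ↔ (f ⟨d, hd⟩)⁻¹ * (a : A ⧸ H) = 1
    rw [mem_goursatSubgroup, inv_mul_eq_one]
    exact ⟨fun h => h.2, fun h => ⟨hd, h⟩⟩
  rw [← Subgroup.relIndex_mul_index hle, hQ, Subgroup.relIndex, hker, Subgroup.index_ker,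
    MonoidHom.range_eq_top.2 hψ, Subgroup.card_top]
  rfl

/-- Goursat's lemma for subgroups of `A × D` with `A` commutative. -/
theorem goursatSubgroup_bijective : Function.Bijective
    (fun p : Σ (H : Subgroup A) (P : Subgroup D), (P →* A ⧸ H) =>
      goursatSubgroup p.1 p.2.1 p.2.2) := by
  constructor
  · rintro ⟨H, P, f⟩ ⟨H', P', f'⟩ h
    have hm : ∀ a d, (a, d) ∈ goursatSubgroup H P f ↔ (a, d) ∈ goursatSubgroup H' P' f' :=
      fun a d => by rw [show goursatSubgroup H P f = goursatSubgroup H' P' f' from h]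
    -- `H` and `P` are recovered as the intersection with `A` and the projection to `D`.
    have hH : ∀ (H : Subgroup A) (P : Subgroup D) (f : P →* A ⧸ H) (a : A),
        a ∈ H ↔ (a, 1) ∈ goursatSubgroup H P f := by
      intro H P f a
      rw [mem_goursatSubgroup, ← QuotientGroup.eq_one_iff, eq_comm]
      constructor
      · intro h
        exact ⟨P.one_mem, f.map_one.trans h⟩
      · rintro ⟨h1, h2⟩
        exact f.map_one.symm.trans h2
    have hP : ∀ (H : Subgroup A) (P : Subgroup D) (f : P →* A ⧸ H) (d : D),
        d ∈ P ↔ ∃ a, (a, d) ∈ goursatSubgroup H P f := by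
      intro H P f d
      constructor
      · intro h
        obtain ⟨a, ha⟩ := QuotientGroup.mk_surjective (f ⟨d, h⟩)
        exact ⟨a, h, ha.symm⟩
      · rintro ⟨a, h, -⟩
        exact h
    obtain rfl : H = H' := by
      ext a
      rw [hH H P f, hm, ← hH]
    obtain rfl : P = P' := by
      ext d
      rw [hP H P f, hP H P' f']
      simp only [hm]
    obtain rfl : f = f' := by
      ext ⟨d, hd⟩
      obtain ⟨a, ha⟩ := QuotientGroup.mk_surjective (f ⟨d, hd⟩)
      obtain ⟨_, h2⟩ := (hm a d).1 ⟨hd, ha.symm⟩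
      exact ha.symm.trans h2.symm
    rfl
  · intro K
    let H : Subgroup A := K.comap (MonoidHom.inl A D)
    let P : Subgroup D := K.map (MonoidHom.snd A D)
    have hP : ∀ d : P, ∃ a, (a, (d : D)) ∈ K := by
      rintro ⟨d, ⟨a, d'⟩, h, rfl⟩
      exact ⟨a, h⟩
    choose F hF using hP
    -- The part of `K` over a fixed `d` is one coset of `H`. Hence `f` below is multiplicative
    -- although the lifts `F` are arbitrary choices.
    have key : ∀ a a' d, (a, d) ∈ K → ((a', d) ∈ K ↔ (a : A ⧸ H) = a') := by
      intro a a' d h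
      rw [QuotientGroup.eq, Subgroup.mem_comap, MonoidHom.inl_apply]
      have e : (a', d) = (a, d) * (a⁻¹ * a', 1) := by simp
      rw [e, Subgroup.mul_mem_cancel_left _ h]
    let f : P →* A ⧸ H := MonoidHom.mk' (fun d => (F d : A ⧸ H)) (by
      intro d d'
      rw [← QuotientGroup.mk_mul, ← key _ _ _ (hF (d * d'))]
      exact K.mul_mem (hF d) (hF d'))
    refine ⟨⟨H, P, f⟩, ?_⟩
    ext ⟨a, d⟩
    rw [mem_goursatSubgroup]
    constructor
    · rintro ⟨h, e⟩
      exact (key _ _ _ (hF ⟨d, h⟩)).2 e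
    · intro h
      have hd : d ∈ P := ⟨(a, d), h, rfl⟩
      exact ⟨hd, (key _ _ _ (hF ⟨d, hd⟩)).1 h⟩

/-- The number of pairs of an index `m` subgroup `P` of `D` and a homomorphism `P → B`. -/
noncomputable def numSubgroupHoms (m : ℕ) (D B : Type*) [Group D] [Group B] : ℕ :=
  Nat.card (Σ P : {P : Subgroup D // P.index = m}, P.1 →* B)

end Goursat

/-- Goursat's correspondence sorted by `H`: multiplicativity of the index forces `P` to have index
`n / H.index`. As `n ≠ 0`, that index is nonzero, so `hfin` gives the finiteness needed for
`Nat.card_sigma`. -/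
theorem numSubgroups_prod {A D : Type} [CommGroup A] [Finite A] [Group D] {n : ℕ} (hn : n ≠ 0)
    [Fintype (Subgroup A)]
    (hfin : ∀ (H : Subgroup A) (m : ℕ), m ≠ 0 →
      Finite (Σ P : {P : Subgroup D // P.index = m}, P.1 →* A ⧸ H)) :
    numSubgroups n (A × D) = ∑ H : Subgroup A,
      if H.index ∣ n then numSubgroupHoms (n / H.index) D (A ⧸ H) else 0 := by
  have e1 : {K : Subgroup (A × D) // K.index = n} ≃
      {p : Σ (H : Subgroup A) (P : Subgroup D), (P →* A ⧸ H) //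
        p.1.index * p.2.1.index = n} :=
    ((Equiv.ofBijective _ goursatSubgroup_bijective).subtypeEquiv fun p => by
      rw [Equiv.ofBijective_apply, index_goursatSubgroup]).symm
  have e2 : {p : Σ (H : Subgroup A) (P : Subgroup D), (P →* A ⧸ H) //
        p.1.index * p.2.1.index = n} ≃
      Σ H : Subgroup A, {p : Σ P : Subgroup D, (P →* A ⧸ H) // H.index * p.1.index = n} :=
    { toFun := fun p => ⟨p.1.1, p.1.2, p.2⟩
      invFun := fun p => ⟨⟨p.1, p.2.1⟩, p.2.2⟩
      left_inv := fun _ => rfl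
      right_inv := fun _ => rfl }
  have e3 : ∀ H : Subgroup A, H.index ∣ n →
      Nonempty ({p : Σ P : Subgroup D, (P →* A ⧸ H) // H.index * p.1.index = n} ≃
        Σ P : {P : Subgroup D // P.index = n / H.index}, P.1 →* A ⧸ H) := by
    intro H hH
    have hpos : 0 < H.index := Nat.pos_of_ne_zero H.index_ne_zero_of_finite
    have h : ∀ P : Subgroup D, H.index * P.index = n ↔ P.index = n / H.index := by
      intro P
      obtain ⟨m, rfl⟩ := hH
      rw [Nat.mul_div_cancel_left _ hpos, Nat.mul_right_inj hpos.ne']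
    exact ⟨
      { toFun := fun p => ⟨⟨p.1.1, (h _).1 p.2⟩, p.1.2⟩
        invFun := fun p => ⟨⟨p.1.1, p.2⟩, (h _).2 p.1.2⟩
        left_inv := fun _ => rfl
        right_inv := fun _ => rfl }⟩
  have h4 : ∀ H : Subgroup A, ¬ H.index ∣ n →
      IsEmpty {p : Σ P : Subgroup D, (P →* A ⧸ H) // H.index * p.1.index = n} :=
    fun H hH => ⟨fun p => hH ⟨_, p.2.symm⟩⟩
  have h5 : ∀ H : Subgroup A,
      Finite {p : Σ P : Subgroup D, (P →* A ⧸ H) // H.index * p.1.index = n} := by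
    intro H
    by_cases hH : H.index ∣ n
    · have := hfin H (n / H.index) (Nat.div_ne_zero_iff_of_dvd hH |>.2
        ⟨hn, H.index_ne_zero_of_finite⟩)
      exact Finite.of_equiv _ (e3 H hH).some.symm
    · have := h4 H hH
      infer_instance
  rw [numSubgroups, Nat.card_congr (e1.trans e2), Nat.card_sigma]
  refine Finset.sum_congr rfl fun H _ => ?_
  split_ifs with hH
  · exact Nat.card_congr (e3 H hH).some
  · have := h4 H hH
    exact Nat.card_of_isEmpty

/-- Labels for left cosets; `F` need not be a homomorphism, as the dihedral subgroups below are not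
normal in general. -/
theorem Subgroup.index_eq_card_of_fibers {G X : Type*} [Group G] (P : Subgroup G) (F : G → X)
    (hF : Function.Surjective F) (h : ∀ a b, F a = F b ↔ a⁻¹ * b ∈ P) :
    P.index = Nat.card X := by
  refine Nat.card_congr (Equiv.ofBijective (Quotient.lift F fun a b hab =>
    (h a b).2 (QuotientGroup.leftRel_apply.1 hab)) ⟨?_, ?_⟩)
  · rintro ⟨a⟩ ⟨b⟩ hab
    exact Quotient.sound (QuotientGroup.leftRel_apply.2 ((h a b).1 hab))
  · intro x
    obtain ⟨a, rfl⟩ := hF x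
    exact ⟨(a : G ⧸ P), rfl⟩

/-! ### Subgroups of the infinite dihedral group -/

namespace DihedralGroup

/-- The rotations of the infinite dihedral group, indexed by integers. -/
def rotation (i : ℤ) : DihedralGroup 0 := r i

/-- The reflections of the infinite dihedral group, indexed by integers. -/
def reflection (i : ℤ) : DihedralGroup 0 := sr i

theorem rotation_inj {i j : ℤ} : rotation i = rotation j ↔ i = j := ⟨fun h => r.inj h, congrArg _⟩

theorem reflection_inj {i j : ℤ} : reflection i = reflection j ↔ i = j :=
  ⟨fun h => sr.inj h, congrArg _⟩

theorem rotation_ne_reflection {i j : ℤ} : rotation i ≠ reflection j := fun h => by cases h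

theorem rotation_zero : rotation 0 = 1 := rfl

theorem rotation_zpow (i k : ℤ) : rotation i ^ k = rotation (i * k) := r_zpow _ _

theorem rotation_mul_rotation (i j : ℤ) : rotation i * rotation j = rotation (i + j) := rfl

theorem rotation_mul_reflection (i j : ℤ) : rotation i * reflection j = reflection (j - i) := rfl

theorem reflection_mul_rotation (i j : ℤ) : reflection i * rotation j = reflection (i + j) := rfl

theorem reflection_mul_reflection (i j : ℤ) : reflection i * reflection j = rotation (j - i) := rfl

theorem rotation_inv (i : ℤ) : (rotation i)⁻¹ = rotation (-i) := rfl

theorem reflection_inv (i : ℤ) : (reflection i)⁻¹ = reflection i := rfl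

theorem forall_dihedral {p : DihedralGroup 0 → Prop} (h1 : ∀ i : ℤ, p (rotation i))
    (h2 : ∀ i : ℤ, p (reflection i)) : ∀ g, p g
  | r i => h1 i
  | sr i => h2 i

/-- The endomorphism of the infinite dihedral group with `r i ↦ r (d i)` and
`sr i ↦ sr (c + d i)`. -/
def dilation (d c : ℤ) : DihedralGroup 0 →* DihedralGroup 0 :=
  MonoidHom.mk' (fun g => match g with
    | r i => rotation (d * (show ℤ from i))
    | sr i => reflection (c + d * (show ℤ from i))) (by
    refine forall_dihedral (fun i => forall_dihedral (fun j => ?_) fun j => ?_)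
      (fun i => forall_dihedral (fun j => ?_) fun j => ?_)
    · exact congrArg rotation (mul_add d i j)
    · exact congrArg reflection (show c + d * (j - i) = c + d * j - d * i by ring)
    · exact congrArg reflection (show c + d * (i + j) = c + d * i + d * j by ring)
    · exact congrArg rotation (show d * (j - i) = c + d * j - (c + d * i) by ring))

theorem dilation_rotation (d c i : ℤ) : dilation d c (rotation i) = rotation (d * i : ℤ) := rfl

theorem dilation_reflection (d c i : ℤ) : dilation d c (reflection i) = reflection (c + d * i : ℤ) := rfl

theorem dilation_injective {d : ℤ} (hd : d ≠ 0) (c : ℤ) : Function.Injective (dilation d c) := by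
  rw [injective_iff_map_eq_one]
  refine forall_dihedral (fun i h => ?_) fun i h => ?_
  · rw [dilation_rotation, ← rotation_zero, rotation_inj] at h
    rw [(mul_eq_zero.1 h).resolve_left hd, rotation_zero]
  · exact absurd h.symm rotation_ne_reflection

/-- The infinite dihedral subgroup of index `d` generated by the rotation `r d` and the
reflection `sr c`. -/
def dihedralSubgroup (d c : ℤ) : Subgroup (DihedralGroup 0) := (dilation d c).range

theorem rotation_mem_dihedralSubgroup {d c i : ℤ} : rotation i ∈ dihedralSubgroup d c ↔ d ∣ i := by
  constructor
  · rintro ⟨g, h⟩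
    revert g
    exact forall_dihedral (fun j h => ⟨j, (rotation_inj.1 h).symm⟩)
      fun j h => absurd h.symm rotation_ne_reflection
  · rintro ⟨j, rfl⟩
    exact ⟨rotation j, rfl⟩

theorem reflection_mem_dihedralSubgroup {d c i : ℤ} :
    reflection i ∈ dihedralSubgroup d c ↔ d ∣ i - c := by
  constructor
  · rintro ⟨g, h⟩
    revert g
    refine forall_dihedral (fun j h => absurd h rotation_ne_reflection) fun j h => ⟨j, ?_⟩
    rw [dilation_reflection, reflection_inj] at h
    rw [← h, add_sub_cancel_left]
  · rintro ⟨j, h⟩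
    refine ⟨reflection j, ?_⟩
    rw [dilation_reflection, ← h, add_sub_cancel]

theorem rotation_mem_zpowers {d i : ℤ} : rotation i ∈ Subgroup.zpowers (rotation d) ↔ d ∣ i := by
  simp only [Subgroup.mem_zpowers_iff, rotation_zpow, rotation_inj, dvd_def, eq_comm]

theorem reflection_notMem_zpowers {d i : ℤ} : reflection i ∉ Subgroup.zpowers (rotation d) := by
  simp only [Subgroup.mem_zpowers_iff, rotation_zpow, rotation_ne_reflection, exists_false,
    not_false_iff]

theorem index_dihedralSubgroup (d : ℕ) (c : ℤ) : (dihedralSubgroup d c).index = d := by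
  -- The left coset of `r i` contains the reflections `sr (c - i + d k)`, so `sr j` gets the label
  -- `c - j`.
  let F : DihedralGroup 0 → ZMod d := fun g => match g with
    | r i => ((show ℤ from i : ℤ) : ZMod d)
    | sr i => ((c - (show ℤ from i) : ℤ) : ZMod d)
  have hr : ∀ i : ℤ, F (rotation i) = (i : ZMod d) := fun _ => rfl
  have hs : ∀ i : ℤ, F (reflection i) = ((c - i : ℤ) : ZMod d) := fun _ => rfl
  rw [Subgroup.index_eq_card_of_fibers _ F, Nat.card_zmod]
  · intro z
    obtain ⟨i, rfl⟩ := ZMod.intCast_surjective z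
    exact ⟨rotation i, rfl⟩
  · refine forall_dihedral (fun i => forall_dihedral (fun j => ?_) fun j => ?_)
      (fun i => forall_dihedral (fun j => ?_) fun j => ?_)
    · rw [rotation_inv, rotation_mul_rotation, neg_add_eq_sub, hr, hr, rotation_mem_dihedralSubgroup,
        ZMod.intCast_eq_intCast_iff_dvd_sub]
    · rw [rotation_inv, rotation_mul_reflection, sub_neg_eq_add, hr, hs, reflection_mem_dihedralSubgroup,
        ZMod.intCast_eq_intCast_iff_dvd_sub,
        show c - j - i = -(j + i - c) by ring, dvd_neg]
    · rw [reflection_inv, reflection_mul_rotation, hr, hs, reflection_mem_dihedralSubgroup,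
        ZMod.intCast_eq_intCast_iff_dvd_sub,
        show j - (c - i) = i + j - c by ring]
    · rw [reflection_inv, reflection_mul_reflection, hs, hs, rotation_mem_dihedralSubgroup,
        ZMod.intCast_eq_intCast_iff_dvd_sub,
        sub_sub_sub_cancel_left, ← dvd_neg, neg_sub]

theorem index_zpowers_r (d : ℕ) :
    (Subgroup.zpowers (rotation ((d : ℤ) : ℤ))).index = d * 2 := by
  let F : DihedralGroup 0 → ZMod d × Bool := fun g => match g with
    | r i => (((show ℤ from i : ℤ) : ZMod d), true)
    | sr i => (((show ℤ from i : ℤ) : ZMod d), false)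
  have hr : ∀ i : ℤ, F (rotation i) = ((i : ZMod d), true) := fun _ => rfl
  have hs : ∀ i : ℤ, F (reflection i) = ((i : ZMod d), false) := fun _ => rfl
  rw [Subgroup.index_eq_card_of_fibers _ F, Nat.card_prod, Nat.card_zmod]
  · simp
  · rintro ⟨z, b⟩
    obtain ⟨i, rfl⟩ := ZMod.intCast_surjective z
    cases b
    · exact ⟨reflection i, rfl⟩
    · exact ⟨rotation i, rfl⟩
  · refine forall_dihedral (fun i => forall_dihedral (fun j => ?_) fun j => ?_)
      (fun i => forall_dihedral (fun j => ?_) fun j => ?_)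
    · rw [rotation_inv, rotation_mul_rotation, neg_add_eq_sub, hr, hr, rotation_mem_zpowers, Prod.mk.injEq,
        ZMod.intCast_eq_intCast_iff_dvd_sub]
      simp
    · rw [rotation_inv, rotation_mul_reflection, sub_neg_eq_add, hr, hs]
      simp [reflection_notMem_zpowers]
    · rw [reflection_inv, reflection_mul_rotation, hr, hs]
      simp [reflection_notMem_zpowers]
    · rw [reflection_inv, reflection_mul_reflection, hs, hs, rotation_mem_zpowers, Prod.mk.injEq,
        ZMod.intCast_eq_intCast_iff_dvd_sub]
      simp

/-- The finite index subgroups of the infinite dihedral group. -/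
theorem eq_dihedralSubgroup_or_eq_zpowers (P : Subgroup (DihedralGroup 0)) :
    (∃ c : ℤ, P = dihedralSubgroup P.index c) ∨
      ∃ d : ℕ, P.index = d * 2 ∧ P = Subgroup.zpowers (rotation (d : ℤ)) := by
  -- The rotations in `P` form a subgroup `dℤ` of `ℤ`. The case `d = 0` is allowed: the index is
  -- then infinite, recorded as 0.
  let R : AddSubgroup ℤ :=
    { carrier := rotation ⁻¹' P
      zero_mem' := P.one_mem
      add_mem' := fun {i j} hi hj => P.mul_mem hi hj
      neg_mem' := fun {i} hi => P.inv_mem hi }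
  obtain ⟨d, hd⟩ : ∃ d : ℕ, ∀ i : ℤ, rotation i ∈ P ↔ (d : ℤ) ∣ i := by
    obtain ⟨a, ha⟩ := Int.subgroup_cyclic R
    refine ⟨a.natAbs, fun i => ?_⟩
    have h1 : i ∈ R ↔ a ∣ i := by
      rw [ha, ← AddSubgroup.zmultiples_eq_closure, Int.mem_zmultiples_iff]
    rw [Int.natAbs_dvd]
    exact h1
  by_cases h : ∃ c : ℤ, reflection c ∈ P
  · obtain ⟨c, hc⟩ := h
    have e : P = dihedralSubgroup d c := by
      ext g
      revert g
      refine forall_dihedral (fun i => ?_) fun i => ?_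
      · rw [hd, rotation_mem_dihedralSubgroup]
      -- One reflection `sr c` in `P` determines all of them, since `sr c * sr i = r (i - c)`.
      · rw [reflection_mem_dihedralSubgroup, ← hd, ← P.mul_mem_cancel_left hc]
        rfl
    have hi : P.index = d := by rw [e, index_dihedralSubgroup]
    exact Or.inl ⟨c, by rw [hi]; exact e⟩
  · have e : P = Subgroup.zpowers (rotation (d : ℤ)) := by
      ext g
      revert g
      refine forall_dihedral (fun i => ?_) fun i => ?_
      · rw [hd, rotation_mem_zpowers]
      · exact iff_of_false (fun hi => h ⟨i, hi⟩) reflection_notMem_zpowers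
    refine Or.inr ⟨d, ?_, e⟩
    rw [← index_zpowers_r, ← e]

/-- The subgroups of index `m ≥ 1` of the infinite dihedral group: `m` infinite dihedral ones, and
an infinite cyclic one if `m` is even. -/
def subgroupOfIndex (m : ℕ) :
    Fin m ⊕ {_u : Unit // 2 ∣ m} → {P : Subgroup (DihedralGroup 0) // P.index = m}
  | Sum.inl c => ⟨dihedralSubgroup m (c : ℕ), index_dihedralSubgroup m _⟩
  | Sum.inr u => ⟨Subgroup.zpowers (rotation ((m / 2 : ℕ) : ℤ)), by
      rw [index_zpowers_r, Nat.div_mul_cancel u.2]⟩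

theorem subgroupOfIndex_bijective {m : ℕ} (hm : m ≠ 0) :
    Function.Bijective (subgroupOfIndex m) := by
  have hne : ∀ (c : ℤ) (d : ℤ), dihedralSubgroup m c ≠ Subgroup.zpowers (rotation d) := by
    intro c d h
    have h1 : reflection c ∈ dihedralSubgroup m c := reflection_mem_dihedralSubgroup.2 (by simp)
    rw [h] at h1
    exact reflection_notMem_zpowers h1
  constructor
  · rintro (c | u) (c' | u') h
    · have h1 : dihedralSubgroup m (c : ℕ) = dihedralSubgroup m (c' : ℕ) :=
        congrArg Subtype.val h
      have h2 : reflection ((c : ℕ) : ℤ) ∈ dihedralSubgroup m (c : ℕ) :=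
        reflection_mem_dihedralSubgroup.2 (by simp)
      rw [h1, reflection_mem_dihedralSubgroup, ← Int.modEq_iff_dvd, Int.natCast_modEq_iff] at h2
      have h3 : (c : ℕ) = c' := (h2.eq_of_lt_of_lt c'.2 c.2).symm
      rw [Fin.ext h3]
    · exact absurd (congrArg Subtype.val h) (hne _ _)
    · exact absurd (congrArg Subtype.val h).symm (hne _ _)
    · exact congrArg Sum.inr (Subsingleton.elim u u')
  · rintro ⟨P, hP⟩
    rcases eq_dihedralSubgroup_or_eq_zpowers P with ⟨c, h⟩ | ⟨d, h1, h⟩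
    · rw [hP] at h
      have hm' : (m : ℤ) ≠ 0 := by exact_mod_cast hm
      have h0 := Int.emod_nonneg c hm'
      have h1 := Int.emod_lt_of_pos c (b := m) (by omega)
      refine ⟨Sum.inl ⟨(c % m).toNat, by omega⟩, Subtype.ext ?_⟩
      refine Eq.trans ?_ h.symm
      change dihedralSubgroup m ((c % m).toNat : ℕ) = dihedralSubgroup m c
      rw [Int.toNat_of_nonneg h0]
      ext g
      revert g
      refine forall_dihedral (fun i => ?_) fun i => ?_
      · rw [rotation_mem_dihedralSubgroup, rotation_mem_dihedralSubgroup]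
      · rw [reflection_mem_dihedralSubgroup, reflection_mem_dihedralSubgroup]
        have e : i - c % m = (i - c) + m * (c / m) := by
          have := Int.emod_add_mul_ediv c m
          linarith
        rw [e, dvd_add_left (Dvd.intro _ rfl)]
    · refine ⟨Sum.inr ⟨(), ?_⟩, Subtype.ext ?_⟩
      · rw [← hP, h1]
        exact Dvd.intro_left _ rfl
      · refine Eq.trans ?_ h.symm
        change Subgroup.zpowers _ = _
        rw [← hP, h1, Nat.mul_div_cancel _ two_pos]

/-! ### Homomorphisms from subgroups of the infinite dihedral group -/

section HomCount

variable {B : Type*} [Group B]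

/-- For `d ≠ 0` the subgroup is a copy of `D∞`, and two reflections generating it may go to any two
elements of `B`, all of which square to 1. -/
theorem card_dihedralSubgroup_hom [Finite B] (hB : ∀ x : B, x * x = 1) {d : ℤ} (hd : d ≠ 0) (c : ℤ) :
    Finite (dihedralSubgroup d c →* B) ∧
      Nat.card (dihedralSubgroup d c →* B) = Nat.card B * Nat.card B := by
  let e := ((MonoidHom.ofInjective (dilation_injective hd c)).symm.monoidHomCongrLeftEquiv
    (N := B)).trans (homEquivOfExponentTwo hB)
  exact ⟨Finite.of_equiv _ e.symm, by rw [← Nat.card_prod]; exact Nat.card_congr e⟩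

theorem card_zpowers_hom [Finite B] {d : ℤ} (hd : d ≠ 0) :
    Finite (Subgroup.zpowers (rotation d : DihedralGroup 0) →* B) ∧
      Nat.card (Subgroup.zpowers (rotation d : DihedralGroup 0) →* B) = Nat.card B := by
  have hinj : Function.Injective (zpowersHom (DihedralGroup 0) (rotation d)) := by
    rw [injective_iff_map_eq_one]
    intro k h
    rw [zpowersHom_apply, rotation_zpow, ← rotation_zero, rotation_inj] at h
    exact congrArg Multiplicative.ofAdd ((mul_eq_zero.1 h).resolve_left hd)
  let e := ((MonoidHom.ofInjective hinj).symm.monoidHomCongrLeftEquiv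
    (N := B)).trans (zpowersHom B).symm
  exact ⟨Finite.of_equiv _ e.symm, Nat.card_congr e⟩

/-- The number of homomorphisms from index `m` subgroups of the infinite dihedral group to a
finite group of exponent dividing 2. -/
theorem numSubgroupHoms_infiniteDihedral [Finite B] (hB : ∀ x : B, x * x = 1) {m : ℕ} (hm : m ≠ 0) :
    Finite (Σ P : {P : Subgroup (DihedralGroup 0) // P.index = m}, P.1 →* B) ∧
      numSubgroupHoms m (DihedralGroup 0) B =
        m * Nat.card B ^ 2 + if 2 ∣ m then Nat.card B else 0 := by
  classical
  let e := Equiv.ofBijective _ (subgroupOfIndex_bijective hm)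
  have hf : ∀ x, Finite ((e x).1 →* B) ∧ Nat.card ((e x).1 →* B) =
      Sum.elim (fun _ => Nat.card B ^ 2) (fun _ => Nat.card B) x := by
    rintro (c | u)
    · have := card_dihedralSubgroup_hom hB (d := m) (by exact_mod_cast hm) (c : ℕ)
      rw [Sum.elim_inl, sq]
      exact this
    · have h2 := Nat.div_mul_cancel u.2
      exact card_zpowers_hom (B := B) (d := (m / 2 : ℕ)) (by omega)
  have : ∀ x, Finite ((e x).1 →* B) := fun x => (hf x).1
  let E : (Σ x, ((e x).1 →* B)) ≃
      (Σ P : {P : Subgroup (DihedralGroup 0) // P.index = m}, P.1 →* B) :=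
    Equiv.sigmaCongrLeft (β := fun P : {P : Subgroup (DihedralGroup 0) // P.index = m} =>
      (P.1 →* B)) e
  refine ⟨Finite.of_equiv _ E, ?_⟩
  rw [numSubgroupHoms, ← Nat.card_congr E, Nat.card_sigma,
    Finset.sum_congr rfl fun x _ => (hf x).2, Fintype.sum_sum_type]
  simp only [Sum.elim_inl, Sum.elim_inr, Finset.sum_const, Finset.card_univ, Fintype.card_fin,
    smul_eq_mul]
  congr 1
  rw [Fintype.card_subtype]
  split_ifs with h <;> simp [h]

end HomCount

end DihedralGroup

/-! ### Subgroup count for `(ℤ/2ℤ)^r × D∞` -/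

theorem numSubgroups_elemAbTwo_prod (r : ℕ) {n : ℕ} (hn : n ≠ 0) :
    numSubgroups n (ElemAbTwo r × DihedralGroup 0) = ∑ j ∈ Finset.range (r + 1),
      numSubgroups (2 ^ j) (ElemAbTwo r) *
        ((if 2 ^ j ∣ n then n * 2 ^ j else 0) + if 2 ^ (j + 1) ∣ n then 2 ^ j else 0) := by
  classical
  have := Fintype.ofFinite (Subgroup (ElemAbTwo r))
  have hcount : ∀ (H : Subgroup (ElemAbTwo r)) {m : ℕ}, m ≠ 0 → _ := fun H m hm =>
    DihedralGroup.numSubgroupHoms_infiniteDihedral (B := ElemAbTwo r ⧸ H) (m := m) (by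
      rintro ⟨a⟩
      exact congrArg (QuotientGroup.mk (s := H)) (elemAbTwo_mul_self a)) hm
  rw [numSubgroups_prod hn fun H m hm => (hcount H hm).1]
  have hterm : ∀ H : Subgroup (ElemAbTwo r),
      (if H.index ∣ n then
        numSubgroupHoms (n / H.index) (DihedralGroup 0) (ElemAbTwo r ⧸ H) else 0) =
      (if H.index ∣ n then n * H.index else 0) + if H.index * 2 ∣ n then H.index else 0 := by
    intro H
    have hpos : 0 < H.index := Nat.pos_of_ne_zero H.index_ne_zero_of_finite
    by_cases h : H.index ∣ n
    · obtain ⟨m, rfl⟩ := h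
      have hm : m ≠ 0 := by rintro rfl; exact hn (mul_zero _)
      rw [if_pos (Dvd.intro _ rfl), if_pos (Dvd.intro _ rfl), Nat.mul_div_cancel_left _ hpos,
        (hcount H hm).2, ← Subgroup.index]
      congr 1
      -- Here `n = q m` with `q` both the index of `H` and the order of the quotient, so `m q ^ 2 =
      -- n q`.
      · ring
      · simp only [Nat.mul_dvd_mul_iff_left hpos]
    · rw [if_neg h, if_neg h, if_neg fun h2 => h (dvd_trans (Dvd.intro _ rfl) h2)]
  have hidx : ∀ H : Subgroup (ElemAbTwo r), ∃ j ∈ Finset.range (r + 1), H.index = 2 ^ j := by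
    intro H
    have h1 : H.index ∣ 2 ^ r := by
      have := H.index_dvd_card
      simpa using this
    obtain ⟨j, hj, h2⟩ := (Nat.dvd_prime_pow Nat.prime_two).1 h1
    exact ⟨j, Finset.mem_range.2 (by omega), h2⟩
  choose d hd hd' using hidx
  rw [Finset.sum_congr rfl fun H _ => hterm H,
    ← Finset.sum_fiberwise_of_maps_to (g := d) (fun H _ => hd H)]
  refine Finset.sum_congr rfl fun j _ => ?_
  have hj : ∀ H, d H = j ↔ H.index = 2 ^ j := fun H => by
    rw [hd' H]
    exact (Nat.pow_right_injective le_rfl).eq_iff.symm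
  rw [numSubgroups, Nat.card_eq_fintype_card, Fintype.card_subtype, ← smul_eq_mul,
    ← Finset.sum_const]
  simp only [hj]
  refine Finset.sum_congr rfl fun H hH => ?_
  rw [(Finset.mem_filter.1 hH).2, pow_succ]

/-! ### Logarithmic derivatives and Taylor coefficients -/

open Filter Topology

/-- `1 - x ^ N` has positive real part, so the principal power is differentiable there. -/
theorem norm_pow_lt_one_and_one_sub_pow_ne_zero {x : ℂ} (hx : ‖x‖ < 1) {N : ℕ} (hN : N ≠ 0) :
    ‖x ^ N‖ < 1 ∧ 1 - x ^ N ∈ Complex.slitPlane ∧ 1 - x ^ N ≠ 0 := by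
  have h1 : ‖x ^ N‖ < 1 := by
    rw [norm_pow]
    exact pow_lt_one₀ (norm_nonneg _) hx hN
  have h2 : 1 - x ^ N ∈ Complex.slitPlane := by
    refine Or.inl ?_
    have := (Complex.re_le_norm (x ^ N)).trans_lt h1
    simpa using this
  exact ⟨h1, h2, Complex.slitPlane_ne_zero h2⟩

/-- Sums supported on the exponents `N (m + 1) - 1`. -/
theorem hasSum_ite_dvd_succ {N : ℕ} (hN : N ≠ 0) {u : ℕ → ℂ} {v : ℂ}
    (h : HasSum (fun m => u (N * m + (N - 1))) v) :
    HasSum (fun i => if N ∣ i + 1 then u i else 0) v := by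
  have hinj : Function.Injective fun m => N * m + (N - 1) := fun a b hab => by
    simpa [hN] using hab
  have hsucc : ∀ m, N * m + (N - 1) + 1 = N * (m + 1) := fun m => by
    rw [mul_add, mul_one, add_assoc, Nat.sub_add_cancel (Nat.pos_of_ne_zero hN)]
  rw [← hinj.hasSum_iff]
  · refine h.congr_fun fun m => ?_
    rw [Function.comp_apply, if_pos (hsucc m ▸ Dvd.intro _ rfl)]
  · intro i hi
    refine if_neg fun ⟨k, hk⟩ => hi ⟨k - 1, ?_⟩
    have hk0 : k ≠ 0 := by rintro rfl; simp at hk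
    have := hsucc (k - 1)
    rw [Nat.sub_add_cancel (Nat.pos_of_ne_zero hk0), ← hk] at this
    exact Nat.succ_injective this

theorem hasSum_ite_dvd_geometric {x : ℂ} (hx : ‖x‖ < 1) {N : ℕ} (hN : N ≠ 0) :
    HasSum (fun i => if N ∣ i + 1 then x ^ i else 0) (x ^ (N - 1) / (1 - x ^ N)) := by
  refine hasSum_ite_dvd_succ hN ?_
  have := (hasSum_geometric_of_norm_lt_one (norm_pow_lt_one_and_one_sub_pow_ne_zero hx hN).1).mul_right
    (x ^ (N - 1))
  rw [div_eq_inv_mul]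
  exact this.congr_fun fun m => by rw [pow_add, pow_mul]

theorem hasSum_ite_dvd_succ_mul_geometric {x : ℂ} (hx : ‖x‖ < 1) {N : ℕ} (hN : N ≠ 0) :
    HasSum (fun i => if N ∣ i + 1 then ((i + 1 : ℕ) : ℂ) * x ^ i else 0)
      (N * x ^ (N - 1) / (1 - x ^ N) ^ 2) := by
  obtain ⟨h1, -, h3⟩ := norm_pow_lt_one_and_one_sub_pow_ne_zero hx hN
  refine hasSum_ite_dvd_succ hN ?_
  have := ((hasSum_coe_mul_geometric_of_norm_lt_one h1).add
    (hasSum_geometric_of_norm_lt_one h1)).mul_right (N * x ^ (N - 1))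
  -- With `y = x ^ N`, this is `∑ (m + 1) y ^ m = 1 / (1 - y) ^ 2`, split as `∑ m y ^ m + ∑ y ^ m`.
  have e : (x ^ N / (1 - x ^ N) ^ 2 + (1 - x ^ N)⁻¹) * (N * x ^ (N - 1)) =
      N * x ^ (N - 1) / (1 - x ^ N) ^ 2 := by
    field_simp
    ring
  rw [e] at this
  refine this.congr_fun fun m => ?_
  rw [add_assoc (N * m), Nat.sub_add_cancel (Nat.pos_of_ne_zero hN), pow_add, pow_mul]
  push_cast
  ring

/-- The factor of the product formula with `q = 2 ^ j`. -/
noncomputable def prodFactor (q : ℕ) (s : ℂ) (x : ℂ) : ℂ :=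
  (1 - x ^ (q * 2)) ^ (-s / 2) * Complex.exp (-(q * s) + q * s / (1 - x ^ q))

/-- The logarithmic derivative of `prodFactor q s`. -/
noncomputable def prodFactorLogDeriv (q : ℕ) (s : ℂ) (x : ℂ) : ℂ :=
  s * (q * (q * x ^ (q - 1) / (1 - x ^ q) ^ 2) + q * (x ^ (q * 2 - 1) / (1 - x ^ (q * 2))))

theorem hasDerivAt_prodFactor {q : ℕ} (hq : q ≠ 0) (s : ℂ) {x : ℂ} (hx : ‖x‖ < 1) :
    HasDerivAt (prodFactor q s) (prodFactor q s x * prodFactorLogDeriv q s x) x := by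
  obtain ⟨-, -, h1⟩ := norm_pow_lt_one_and_one_sub_pow_ne_zero hx hq
  obtain ⟨-, h2, h3⟩ := norm_pow_lt_one_and_one_sub_pow_ne_zero hx (mul_ne_zero hq two_ne_zero)
  have d1 : HasDerivAt (fun x : ℂ => 1 - x ^ q) (-(q * x ^ (q - 1))) x :=
    (hasDerivAt_pow q x).const_sub 1
  have d2 : HasDerivAt (fun x : ℂ => 1 - x ^ (q * 2))
      (-((q * 2 : ℕ) * x ^ (q * 2 - 1))) x := (hasDerivAt_pow (q * 2) x).const_sub 1
  have d3 := d2.cpow_const (c := -s / 2) h2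
  have d4 := (((hasDerivAt_const x (q * s : ℂ)).fun_div d1 h1).const_add (-(q * s))).cexp
  refine (d3.fun_mul d4).congr_deriv ?_
  rw [Complex.cpow_sub _ _ h3, Complex.cpow_one]
  simp only [prodFactor, prodFactorLogDeriv]
  push_cast
  field_simp
  ring

/-- The coefficient of `x ^ i` is the summand for `q = 2 ^ j` in the count of subgroups of index `i
+ 1`; this links the algebra to the product formula. -/
theorem hasSum_prodFactorLogDeriv {q : ℕ} (hq : q ≠ 0) (s : ℂ) {x : ℂ} (hx : ‖x‖ < 1) :
    HasSum (fun i : ℕ => x ^ i * (s * ((if q ∣ i + 1 then ((i + 1 : ℕ) : ℂ) * q else 0) +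
      if q * 2 ∣ i + 1 then (q : ℂ) else 0))) (prodFactorLogDeriv q s x) := by
  have h1 := (hasSum_ite_dvd_succ_mul_geometric hx hq).mul_left (q : ℂ)
  have h2 := (hasSum_ite_dvd_geometric hx (mul_ne_zero hq two_ne_zero)).mul_left (q : ℂ)
  refine ((h1.add h2).mul_left s).congr_fun fun i => ?_
  split_ifs <;> push_cast <;> ring

theorem hasDerivAt_prod_of_logDeriv {f l : ℕ → ℂ → ℂ} {x : ℂ}
    (h : ∀ j, HasDerivAt (f j) (f j x * l j x) x) (n : ℕ) :
    HasDerivAt (fun x => ∏ j ∈ Finset.range n, f j x)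
      ((∏ j ∈ Finset.range n, f j x) * ∑ j ∈ Finset.range n, l j x) x := by
  induction n with
  | zero => simpa using hasDerivAt_const x (1 : ℂ)
  | succ n ih =>
    simp only [Finset.prod_range_succ, Finset.sum_range_succ]
    exact (ih.fun_mul (h n)).congr_deriv (by ring)

theorem iteratedDeriv_of_hasSum {L : ℂ → ℂ} {c : ℕ → ℂ}
    (h : ∀ᶠ z in 𝓝 (0 : ℂ), HasSum (fun i => z ^ i * c i) (L z)) :
    AnalyticAt ℂ L 0 ∧ ∀ i, iteratedDeriv i L 0 = i.factorial * c i := by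
  have h1 : HasFPowerSeriesAt L (FormalMultilinearSeries.ofScalars ℂ c) 0 := by
    rw [hasFPowerSeriesAt_iff]
    filter_upwards [h] with z hz
    simpa [FormalMultilinearSeries.coeff_ofScalars] using hz
  refine ⟨h1.analyticAt, fun i => ?_⟩
  have h2 := congrArg (fun p => FormalMultilinearSeries.coeff p i)
    (h1.analyticAt.hasFPowerSeriesAt.eq_formalMultilinearSeries h1)
  simp only [FormalMultilinearSeries.coeff_ofScalars] at h2
  rw [← h2, mul_div_cancel₀]
  exact_mod_cast i.factorial_ne_zero

/-- Taylor coefficients at `0` of a solution of `F' = F L`, from a recursion. -/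
theorem iteratedDeriv_eq_of_recursion {F L : ℂ → ℂ} {c : ℕ → ℂ} {h : ℕ → ℂ}
    (hF : AnalyticAt ℂ F 0) (hL : ∀ᶠ z in 𝓝 (0 : ℂ), HasSum (fun i => z ^ i * c i) (L z))
    (hd : ∀ᶠ z in 𝓝 (0 : ℂ), HasDerivAt F (F z * L z) z) (h0 : F 0 = h 0)
    (hrec : ∀ n, h (n + 1) = ∑ k ∈ Finset.range (n + 1),
      (n.descFactorial k : ℂ) * c k * h (n - k)) (n : ℕ) :
    iteratedDeriv n F 0 = h n := by
  obtain ⟨hLa, hLc⟩ := iteratedDeriv_of_hasSum hL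
  induction n using Nat.strong_induction_on with
  | _ n ih =>
    rcases n with _ | n
    · rw [iteratedDeriv_zero, h0]
    have e : deriv F =ᶠ[𝓝 0] L * F := by
      filter_upwards [hd] with z hz
      rw [hz.deriv, Pi.mul_apply, mul_comm]
    -- Leibniz' rule for `L * F`: the binomial coefficient times the `k!` from the derivative of `L`
    -- is the falling factorial of the recursion.
    rw [iteratedDeriv_succ', e.iteratedDeriv_eq, iteratedDeriv_mul hLa.contDiffAt hF.contDiffAt,
      hrec]
    refine Finset.sum_congr rfl fun k hk => ?_
    rw [Finset.mem_range] at hk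
    rw [hLc, ih (n - k) (by omega), Nat.descFactorial_eq_factorial_mul_choose]
    push_cast
    ring

/-- A function holomorphic on the disc is the sum of its Taylor series on all of it, so identifying
the derivatives at 0 gives both convergence and value. -/
theorem hasSum_of_recursion {F L : ℂ → ℂ} {c : ℕ → ℂ} {h : ℕ → ℂ}
    (hL : ∀ z, ‖z‖ < 1 → HasSum (fun i => z ^ i * c i) (L z))
    (hd : ∀ z, ‖z‖ < 1 → HasDerivAt F (F z * L z) z) (h0 : F 0 = h 0)
    (hrec : ∀ n, h (n + 1) = ∑ k ∈ Finset.range (n + 1),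
      (n.descFactorial k : ℂ) * c k * h (n - k)) {x : ℂ} (hx : ‖x‖ < 1) :
    HasSum (fun n => h n / (n.factorial : ℂ) * x ^ n) (F x) := by
  have hball : ∀ᶠ z in 𝓝 (0 : ℂ), ‖z‖ < 1 := by
    filter_upwards [Metric.ball_mem_nhds (0 : ℂ) one_pos] with z hz
    simpa using hz
  have hdiff : DifferentiableOn ℂ F (Metric.ball 0 1) := fun z hz =>
    (hd z (by simpa using hz)).differentiableAt.differentiableWithinAt
  have han : AnalyticAt ℂ F 0 := hdiff.analyticAt (Metric.ball_mem_nhds _ one_pos)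
  have := Complex.hasSum_taylorSeries_on_ball (r := 1) (z := x) hdiff (by simpa using hx)
  refine this.congr_fun fun n => ?_
  rw [iteratedDeriv_eq_of_recursion han (hball.mono hL) (hball.mono hd) h0 hrec, sub_zero,
    smul_eq_mul, smul_eq_mul]
  ring

theorem theorem4p1 (r : ℕ) (x : ℂ) (hx : ‖x‖ < 1) :
    Summable (genFunTerm r x) ∧
      genFun r x = ∏ j ∈ Finset.range (r + 1),
        ((1 - x ^ (2 ^ (j + 1))) ^ (-(numSubgroups (2 ^ j) (ElemAbTwo r) : ℂ) / 2) *
          Complex.exp (-(2 ^ j * (numSubgroups (2 ^ j) (ElemAbTwo r) : ℂ)) +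
            2 ^ j * (numSubgroups (2 ^ j) (ElemAbTwo r) : ℂ) / (1 - x ^ (2 ^ j)))) := by
  have hq : ∀ j : ℕ, (2 ^ j : ℕ) ≠ 0 := fun j => by positivity
  let s : ℕ → ℂ := fun j => numSubgroups (2 ^ j) (ElemAbTwo r)
  have hs : ∀ i, (numSubgroups (i + 1) (Cox (suspendedCompleteGraph r)) : ℂ) =
      ∑ j ∈ Finset.range (r + 1), s j *
        ((if 2 ^ j ∣ i + 1 then ((i + 1 : ℕ) : ℂ) * (2 ^ j : ℕ) else 0) +
          if 2 ^ j * 2 ∣ i + 1 then ((2 ^ j : ℕ) : ℂ) else 0) := by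
    intro i
    rw [numSubgroups_congr (coxEquiv r), numSubgroups_elemAbTwo_prod r i.succ_ne_zero]
    push_cast [pow_succ]
    rfl
  have main : HasSum (genFunTerm r x)
      (∏ j ∈ Finset.range (r + 1), prodFactor (2 ^ j) (s j) x) := by
    refine hasSum_of_recursion
      (F := fun z => ∏ j ∈ Finset.range (r + 1), prodFactor (2 ^ j) (s j) z)
      (h := fun n => (numPermReps n (Cox (suspendedCompleteGraph r)) : ℂ))
      (c := fun i => (numSubgroups (i + 1) (Cox (suspendedCompleteGraph r)) : ℂ))
      (L := fun z => ∑ j ∈ Finset.range (r + 1), prodFactorLogDeriv (2 ^ j) (s j) z)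
      ?_ ?_ ?_ ?_ hx
    · intro z hz
      simp only [hs, Finset.mul_sum (Finset.range _)]
      exact hasSum_sum fun j _ => hasSum_prodFactorLogDeriv (hq j) (s j) hz
    · intro z hz
      exact hasDerivAt_prod_of_logDeriv (fun j => hasDerivAt_prodFactor (hq j) (s j) hz) _
    -- The initial value is 1 on both sides: at `x = 0` the exponent in each factor cancels.
    · have : numPermReps 0 (Cox (suspendedCompleteGraph r)) = 1 := by
        rw [numPermReps, Nat.card_eq_one_iff_unique]
        exact ⟨⟨fun f g => by ext a b; exact b.elim0⟩, ⟨1⟩⟩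
      rw [this]
      simp [prodFactor]
    · intro n
      rw [numPermReps_succ (fun n => finite_presentedGroup_hom _)]
      push_cast
      rfl
  refine ⟨main.summable, ?_⟩
  rw [genFun, main.tsum_eq]
  refine Finset.prod_congr rfl fun j _ => ?_
  simp only [prodFactor, s, pow_succ]
  push_cast
  rfl
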